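/- Let $m,N\ge 0$ be integers, $V=\mathbb{C}^{N+1}$ with canonical basis $I_0,\dots,I_N$, and let $q\in\mathbb{C}$ be nonzero with $[k]:=1+q^2+\dots+q^{2(k-1)}\ne 0$ for $1\le k\le m$ (for instance, $q$ not a root of unity). For $\sigma\in S_m$ let $\operatorname{inv}(\sigma)$ be its number of inversions. For $1\le i<m$ let $T_i$ act on the $i$-th and $(i+1)$-st factors of $V^{\otimes m}$ by $$I_a\otimes I_a\mapsto q\,I_a\otimes I_a,\qquad I_a\otimes I_b\mapsto I_b\otimes I_a+(q-q^{-1})\,I_a\otimes I_b\ (a<b),\qquad I_a\otimes I_b\mapsto I_b\otimes I_a\ (a>b),$$ (the Hecke algebra action commuting with $U_q(\mathfrak{gl}(N+1))$ acting through $\Delta(\hat e_{\pm,i})=\hat e_{\pm,i}\otimes q^{-h_i/2}+q^{h_i/2}\otimes \hat e_{\pm,i}$), and put $T_w=T_{i_1}\cdots T_{i_l}$ for a reduced expression $w=s_{i_1}\cdots s_{i_l}$ of $w\in S_m$. Let $$P_m=\frac{1}{[1][2]\cdots[m]}\sum_{w\in S_m}q^{\operatorname{inv}(w)}\,T_w$$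 be the $q$-symmetric projection of $V^{\otimes m}$, with image $P_mV^{\otimes m}$. For a sequence $\mu=(\mu_0,\dots,\mu_N)$ of non-negative integers with $\mu_0+\dots+\mu_N=m$, let $D^\mu$ be the set of $\sigma\in S_m$ with the fewest inversions in their left coset $\sigma\,(S_{\mu_0}\times\cdots\times S_{\mu_N})$, and let $$M(\mu)=\sum_{\sigma\in D^\mu}q^{-\operatorname{inv}(\sigma)}\,\sigma\bigl(I_0^{\otimes\mu_0}\otimes\cdots\otimes I_N^{\otimes\mu_N}\bigr),$$ where $\sigma$ acts on $V^{\otimes m}$ by moving the factor in position $k$ to position $\sigma(k)$. Then the vectors $M(\mu)$, indexed by all such sequences $\mu$, form a basis of $P_mV^{\otimes m}$. -/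

import Mathlib

open scoped TensorProduct

namespace QSym

noncomputable section

/-- The number of inversions of a permutation. -/
def inv {m : ℕ} (σ : Equiv.Perm (Fin m)) : ℕ :=
  (Finset.univ.filter fun p : Fin m × Fin m => p.1 < p.2 ∧ σ p.2 < σ p.1).card

/-- Sequences `(μ₀, …, μ_N)` of non-negative integers with sum `m`. -/
abbrev Comp (m N : ℕ) : Type := {μ : Fin (N + 1) → ℕ // ∑ i, μ i = m}

/-- The sequence `0, …, 0, 1, …, 1, …, N, …, N` with `μ_j` entries `j`:
the index of the block of `μ` that contains the position `k`. -/
def letter {m N : ℕ} (μ : Comp m N) (k : Fin m) : Fin (N + 1) :=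
  (finSigmaFinEquiv.symm (Fin.cast μ.2.symm k)).1

/-- The subgroup `S_{μ₀} × ⋯ × S_{μ_N}` of `S_m` (permutations preserving each block of `μ`). -/
def young {m N : ℕ} (μ : Comp m N) : Subgroup (Equiv.Perm (Fin m)) where
  carrier := {σ | ∀ k, letter μ (σ k) = letter μ k}
  mul_mem' := by
    intro a b ha hb k
    rw [Equiv.Perm.mul_apply, ha, hb]
  one_mem' := fun _ => rfl
  inv_mem' := by
    intro a ha k
    have h := ha (a⁻¹ k)
    have h2 : a (a⁻¹ k) = k := a.apply_symm_apply k
    rw [h2] at h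
    exact h.symm

open Classical in
/-- Representatives with the fewest inversions of the left cosets `σ S_μ`. -/
def minReps {m N : ℕ} (μ : Comp m N) : Finset (Equiv.Perm (Fin m)) :=
  Finset.univ.filter fun σ => ∀ h ∈ young μ, inv σ ≤ inv (σ * h)

/-- `V^{⊗ m}` for `V = ℂ^{N+1}`. -/
abbrev Tens (m N : ℕ) : Type := ⨂[ℂ] _ : Fin m, (Fin (N + 1) → ℂ)

/-- `I_{a 0} ⊗ ⋯ ⊗ I_{a (m-1)}`, where `I_0, …, I_N` is the canonical basis of `V`. -/
def pureTensor {m N : ℕ} (a : Fin m → Fin (N + 1)) : Tens m N :=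
  PiTensorProduct.tprod ℂ fun k => (Pi.single (a k) 1 : Fin (N + 1) → ℂ)

/-- `I_0^{⊗ μ₀} ⊗ ⋯ ⊗ I_N^{⊗ μ_N}`. -/
def vec {m N : ℕ} (μ : Comp m N) : Tens m N := pureTensor (letter μ)

/-- The action of `σ ∈ S_m` on `V^{⊗ m}` by place permutations: the factor in position `k`
is moved to position `σ k`. -/
def place {m N : ℕ} (σ : Equiv.Perm (Fin m)) : Tens m N ≃ₗ[ℂ] Tens m N :=
  PiTensorProduct.reindex ℂ (fun _ => Fin (N + 1) → ℂ) σ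

/-- `M(μ) = ∑_{σ ∈ D^μ} q^{-inv σ} σ(v(μ))`. -/
def M {m N : ℕ} (q : ℂ) (μ : Comp m N) : Tens m N :=
  ∑ σ ∈ minReps μ, (q ^ inv σ)⁻¹ • place σ (vec μ)

/-- The tensor basis `I_{a 0} ⊗ ⋯ ⊗ I_{a (m-1)}` of `V^{⊗ m}`. -/
def tensBasis (m N : ℕ) : Module.Basis (Fin m → Fin (N + 1)) ℂ (Tens m N) :=
  Basis.piTensorProduct fun _ => Pi.basisFun ℂ (Fin (N + 1))

theorem tensBasis_apply {m N : ℕ} (a : Fin m → Fin (N + 1)) :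
    tensBasis m N a = pureTensor a := by
  simp [tensBasis, pureTensor, Basis.piTensorProduct_apply, Pi.basisFun_apply]

/-- Of the two neighbouring positions exchanged by the `i`-th simple transposition, the left one. -/
def lo {m : ℕ} (i : Fin (m - 1)) : Fin m := ⟨i, by omega⟩

/-- Of the two neighbouring positions exchanged by the `i`-th simple transposition, the right one. -/
def hi {m : ℕ} (i : Fin (m - 1)) : Fin m := ⟨i + 1, by omega⟩

/-- The simple transpositions of `S_m`. -/
def simpleRefl {m : ℕ} (i : Fin (m - 1)) : Equiv.Perm (Fin m) := Equiv.swap (lo i) (hi i)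

/-- The generator `T_i` of the Hecke algebra acting on `V^{⊗ m}`: in two neighbouring tensor
factors it is the operator on `V ⊗ V` with
`I_a ⊗ I_a ↦ q I_a ⊗ I_a`,
`I_a ⊗ I_b ↦ I_b ⊗ I_a + (q - q⁻¹) I_a ⊗ I_b` for `a < b`,
`I_a ⊗ I_b ↦ I_b ⊗ I_a` for `a > b`.
It is the flip composed with the (rescaled) `R`-matrix of `V ⊗ V`, satisfies
`(T_i - q) (T_i + q⁻¹) = 0`, and commutes with the action of `U_q(gl(N+1))` given by the
coproduct `e ↦ e ⊗ q^{-h/2} + q^{h/2} ⊗ e`. -/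
def heckeGen {m : ℕ} (N : ℕ) (q : ℂ) (i : Fin (m - 1)) : Module.End ℂ (Tens m N) :=
  (tensBasis m N).constr ℂ fun a =>
    if a (lo i) = a (hi i) then q • pureTensor a
    else if a (lo i) < a (hi i) then
      pureTensor (a ∘ simpleRefl i) + (q - q⁻¹) • pureTensor a
    else pureTensor (a ∘ simpleRefl i)

/-- A reduced word of `w`: an expression of `w` as a product of `inv w` simple transpositions. -/
def IsReducedWord {m : ℕ} (l : List (Fin (m - 1))) (w : Equiv.Perm (Fin m)) : Prop :=
  (l.map simpleRefl).prod = w ∧ l.length = inv w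

theorem simpleRefl_lt {m : ℕ} (i : Fin (m - 1)) {a b : Fin m} (hab : a < b)
    (hne : ¬ (a = lo i ∧ b = hi i)) : simpleRefl i a < simpleRefl i b := by
  simp only [simpleRefl, Equiv.swap_apply_def, lo, hi, Fin.ext_iff, Fin.lt_def] at *
  split_ifs <;> simp_all <;> omega

theorem inv_mul_simpleRefl {m : ℕ} (w : Equiv.Perm (Fin m)) (i : Fin (m - 1))
    (h : w (hi i) < w (lo i)) : inv (w * simpleRefl i) + 1 = inv w := by
  have hlt : lo i < hi i := by simp [lo, hi, Fin.lt_def]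
  have hs : ∀ a, simpleRefl i (simpleRefl i a) = a := fun a => by
    simp [simpleRefl, ← Equiv.Perm.mul_apply]
  have hl : simpleRefl i (lo i) = hi i := Equiv.swap_apply_left _ _
  have hr : simpleRefl i (hi i) = lo i := Equiv.swap_apply_right _ _
  have hmem : (lo i, hi i) ∈
      Finset.univ.filter fun p : Fin m × Fin m => p.1 < p.2 ∧ w p.2 < w p.1 := by
    simp [hlt, h]
  unfold inv
  rw [← Finset.card_erase_add_one hmem]
  congr 1
  refine Finset.card_bij' (fun p _ => (simpleRefl i p.1, simpleRefl i p.2))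
    (fun p _ => (simpleRefl i p.1, simpleRefl i p.2)) ?_ ?_ ?_ ?_
  · rintro ⟨a, b⟩ hp
    rw [Finset.mem_filter] at hp
    replace hp := hp.2
    simp only [Equiv.Perm.mul_apply] at hp
    obtain ⟨hab, hw⟩ := hp
    have hne : ¬ (a = lo i ∧ b = hi i) := by
      rintro ⟨rfl, rfl⟩
      rw [hl, hr] at hw
      exact lt_asymm h hw
    simp only [Finset.mem_erase, Finset.mem_filter, Finset.mem_univ, true_and, ne_eq,
      Prod.mk.injEq]
    refine ⟨?_, simpleRefl_lt i hab hne, hw⟩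
    rintro ⟨h1, h2⟩
    have h3 := hs a
    have h4 := hs b
    rw [h1, hl] at h3
    rw [h2, hr] at h4
    rw [← h3, ← h4] at hab
    exact lt_asymm hab hlt
  · rintro ⟨a, b⟩ hp
    simp only [Finset.mem_erase, Finset.mem_filter, Finset.mem_univ, true_and, ne_eq,
      Prod.mk.injEq] at hp
    rw [Finset.mem_filter]
    refine ⟨Finset.mem_univ _, ?_⟩
    simp only [Equiv.Perm.mul_apply, hs]
    exact ⟨simpleRefl_lt i hp.2.1 hp.1, hp.2.2⟩
  · rintro ⟨a, b⟩ _
    simp [hs]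
  · rintro ⟨a, b⟩ _
    simp [hs]

theorem exists_isReducedWord {m : ℕ} (w : Equiv.Perm (Fin m)) :
    ∃ l : List (Fin (m - 1)), IsReducedWord l w := by
  induction hn : inv w generalizing w with
  | zero =>
    refine ⟨[], ?_, by simp [hn]⟩
    have hmono : StrictMono w := by
      intro a b hab
      by_contra hcon
      have hlt : w b < w a :=
        lt_of_le_of_ne (not_lt.mp hcon) (fun hh => hab.ne' (w.injective hh))
      have hmem : (a, b) ∈
          Finset.univ.filter fun p : Fin m × Fin m => p.1 < p.2 ∧ w p.2 < w p.1 := by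
        simp [hab, hlt]
      rw [Finset.card_eq_zero.mp hn] at hmem
      simp at hmem
    have : w = 1 := by
      have h1 : StrictMono.orderIsoOfSurjective w hmono w.surjective = OrderIso.refl _ :=
        Subsingleton.elim _ _
      ext k
      have := congrArg (fun e : Fin m ≃o Fin m => e k) h1
      simpa using congrArg Fin.val this
    simp [this]
  | succ n ih =>
    have hdesc : ∃ i : Fin (m - 1), w (hi i) < w (lo i) := by
      by_contra hcon
      push Not at hcon
      have hmono : ∀ d : ℕ, ∀ a b : Fin m, (b : ℕ) = a + d → w a ≤ w b := by
        intro d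
        induction d with
        | zero =>
          intro a b hab
          rw [show b = a from Fin.ext hab]
        | succ d ihd =>
          intro a b hab
          have hb := b.2
          let c : Fin (m - 1) := ⟨a + d, by omega⟩
          have h1 := ihd a (lo c) rfl
          have h2 := hcon c
          rw [show hi c = b from Fin.ext (by simp [hi, c, hab, add_assoc])] at h2
          exact h1.trans h2
      have : inv w = 0 := by
        unfold inv
        rw [Finset.card_eq_zero, Finset.filter_eq_empty_iff]
        rintro ⟨a, b⟩ _ ⟨hab, hw⟩
        simp only at hab hw
        have := hmono (b - a) a b (by rw [Fin.lt_def] at hab; omega)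
        exact absurd hw (not_lt.mpr this)
      omega
    obtain ⟨i, hi'⟩ := hdesc
    have hinv := inv_mul_simpleRefl w i hi'
    obtain ⟨l, hl1, hl2⟩ := ih (w * simpleRefl i) (by omega)
    refine ⟨l ++ [i], ?_, by simp [hl2]; omega⟩
    rw [List.map_append, List.prod_append, hl1]
    simp [mul_assoc, simpleRefl]

/-- The Hecke algebra element `T_w = T_{i₁} ⋯ T_{i_l}` acting on `V^{⊗ m}`, where
`s_{i₁} ⋯ s_{i_l}` is a reduced word of `w` (by the braid relations it does not matter which). -/
def heckeT {m : ℕ} (N : ℕ) (q : ℂ) (w : Equiv.Perm (Fin m)) : Module.End ℂ (Tens m N) :=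
  ((exists_isReducedWord w).choose.map (heckeGen N q)).prod

/-- `1 + q² + ⋯ + q^{2(k-1)}`. -/
def qInt (q : ℂ) (k : ℕ) : ℂ := ∑ j ∈ Finset.range k, q ^ (2 * j)

/-- The projection `P_m` of `V^{⊗ m}` onto the `q`-symmetric tensors, i.e. the symmetrizer
`(∑_w q^{2 inv w})⁻¹ ∑_w q^{inv w} T_w` of the Hecke algebra, where
`∑_w q^{2 inv w} = ∏_{k=1}^m (1 + q² + ⋯ + q^{2(k-1)})`. -/
def symProj (m N : ℕ) (q : ℂ) : Module.End ℂ (Tens m N) :=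
  (∏ k ∈ Finset.range m, qInt q (k + 1))⁻¹ •
    ∑ w : Equiv.Perm (Fin m), q ^ inv w • heckeT N q w

end

end QSym

/-!
Call a tensor `q`-symmetric if every generator `T_i` acts on it by the scalar `q`. The proof shows
that the image of `P_m` is the space of `q`-symmetric tensors (`range_symProj`), and that the
vectors `M μ` are linearly independent and span this space (`linearIndependent_M`, `span_M`).

*The image of `P_m`.* The generators satisfy the quadratic relation (`heckeGen_sq`) and the braid
relations (`heckeGen_commute`, `heckeGen_braid`), so by Matsumoto's theorem
(`IsReducedWord.prod_map_eq`) `T_w` does not depend on the reduced word, and `T_i T_w` is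
`T_{s_i w}` or `T_{s_i w} + (q - q⁻¹) T_w`. Pairing `w` with `s_i w` in `∑_w q^{inv w} T_w` gives
`T_i P_m = q P_m` (`heckeGen_mul_sum`). Conversely `T_w` acts on a `q`-symmetric tensor by
`q^{inv w}`, so `P_m` fixes it, because `∑_w q^{2 inv w} = [1] ⋯ [m]` (`sum_pow_inv`).

*The basis.* The permutations in `D^μ` are exactly those that increase on each block of `μ`
(`mem_minReps_iff`), and `σ ↦ σ(v(μ))` is a bijection from `D^μ` onto the words with `μ_j` letters
`j` for all `j`. Exchanging two distinct neighbouring letters replaces `σ` by `s_i σ`, which is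
again in `D^μ`. Pairing `σ` with `s_i σ` shows that `M μ` is `q`-symmetric (`M_mem_symTensors`). In
any `q`-symmetric tensor, the coefficient at the word of `σ` is `q^{-inv σ}` times the one at the
sorted word of `μ` (`coeff_of_mem_symTensors`), so the tensor is determined by its coefficients at
sorted words; there `M μ` has the coefficient `1` at the word of `μ` and `0` elsewhere
(`coeff_letter_M`).
-/

namespace QSym

/-! ### Inversions and simple transpositions -/

theorem lo_lt_hi {m : ℕ} (i : Fin (m - 1)) : lo i < hi i := by simp [lo, hi, Fin.lt_def]

theorem simpleRefl_lo {m : ℕ} (i : Fin (m - 1)) : simpleRefl i (lo i) = hi i :=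
  Equiv.swap_apply_left _ _

theorem simpleRefl_hi {m : ℕ} (i : Fin (m - 1)) : simpleRefl i (hi i) = lo i :=
  Equiv.swap_apply_right _ _

theorem simpleRefl_mul_self {m : ℕ} (i : Fin (m - 1)) : simpleRefl i * simpleRefl i = 1 :=
  Equiv.swap_mul_self _ _

theorem simpleRefl_inv {m : ℕ} (i : Fin (m - 1)) : (simpleRefl i)⁻¹ = simpleRefl i :=
  Equiv.swap_inv _ _

theorem inv_one {m : ℕ} : inv (1 : Equiv.Perm (Fin m)) = 0 := by
  unfold inv
  rw [Finset.card_eq_zero, Finset.filter_eq_empty_iff]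
  rintro p _ ⟨h1, h2⟩
  exact lt_asymm h1 h2

theorem inv_inv_eq {m : ℕ} (w : Equiv.Perm (Fin m)) : inv w⁻¹ = inv w := by
  unfold inv
  refine Finset.card_bij' (fun p _ => (w⁻¹ p.2, w⁻¹ p.1)) (fun p _ => (w p.2, w p.1)) ?_ ?_ ?_ ?_
  all_goals
    rintro ⟨a, b⟩ hp
    simp_all

theorem inv_mul_simpleRefl_of_lt {m : ℕ} (w : Equiv.Perm (Fin m)) (i : Fin (m - 1))
    (h : w (lo i) < w (hi i)) : inv (w * simpleRefl i) = inv w + 1 := by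
  have := inv_mul_simpleRefl (w * simpleRefl i) i
    (by simpa [Equiv.Perm.mul_apply, simpleRefl_lo, simpleRefl_hi] using h)
  rw [mul_assoc, simpleRefl_mul_self, mul_one] at this
  exact this.symm

theorem inv_simpleRefl_mul {m : ℕ} (w : Equiv.Perm (Fin m)) (i : Fin (m - 1))
    (h : w⁻¹ (hi i) < w⁻¹ (lo i)) : inv (simpleRefl i * w) + 1 = inv w := by
  have := inv_mul_simpleRefl w⁻¹ i h
  rwa [← inv_inv_eq, mul_inv_rev, inv_inv, simpleRefl_inv, inv_inv_eq] at this

theorem inv_simpleRefl_mul_of_lt {m : ℕ} (w : Equiv.Perm (Fin m)) (i : Fin (m - 1))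
    (h : w⁻¹ (lo i) < w⁻¹ (hi i)) : inv (simpleRefl i * w) = inv w + 1 := by
  have := inv_mul_simpleRefl_of_lt w⁻¹ i h
  rwa [← inv_inv_eq, mul_inv_rev, inv_inv, simpleRefl_inv, inv_inv_eq] at this

theorem lt_or_gt_lo_hi {m : ℕ} (w : Equiv.Perm (Fin m)) (i : Fin (m - 1)) :
    w (lo i) < w (hi i) ∨ w (hi i) < w (lo i) :=
  lt_or_gt_of_ne fun h => (lo_lt_hi i).ne (w.injective h)

theorem inv_list_prod_le {m : ℕ} (l : List (Fin (m - 1))) :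
    inv (l.map simpleRefl).prod ≤ l.length := by
  induction l with
  | nil => simp [inv_one]
  | cons i l ih =>
    rw [List.map_cons, List.prod_cons, List.length_cons]
    rcases lt_or_gt_lo_hi (l.map simpleRefl).prod⁻¹ i with h | h
    · have := inv_simpleRefl_mul_of_lt _ i h; omega
    · have := inv_simpleRefl_mul _ i h; omega

theorem eq_one_of_strictMono {m : ℕ} {w : Equiv.Perm (Fin m)} (h : StrictMono w) : w = 1 := by
  have h1 : StrictMono.orderIsoOfSurjective w h w.surjective = OrderIso.refl _ :=
    Subsingleton.elim _ _
  ext k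
  have := congrArg (fun e : Fin m ≃o Fin m => e k) h1
  simpa using congrArg Fin.val this

/-- A function on positions that does not decrease from any position to the next is monotone. -/
theorem monotone_of_lo_le_hi {m : ℕ} {α : Type*} [Preorder α] {f : Fin m → α}
    (h : ∀ i : Fin (m - 1), f (lo i) ≤ f (hi i)) : Monotone f := by
  have key : ∀ d : ℕ, ∀ a b : Fin m, (b : ℕ) = a + d → f a ≤ f b := by
    intro d
    induction d with
    | zero =>
      intro a b hab
      rw [show b = a from Fin.ext hab]
    | succ d ihd =>
      intro a b hab
      have hb := b.2
      let c : Fin (m - 1) := ⟨a + d, by omega⟩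
      have h1 := ihd a (lo c) rfl
      have h2 := h c
      rw [show hi c = b from Fin.ext (by simp [hi, c, hab, add_assoc])] at h2
      exact h1.trans h2
  intro a b hab
  exact key (b - a) a b (by rw [Fin.le_def] at hab; omega)

/-- A permutation other than the identity has a descent. -/
theorem exists_descent {m : ℕ} {w : Equiv.Perm (Fin m)} (h : w ≠ 1) :
    ∃ i : Fin (m - 1), w (hi i) < w (lo i) := by
  by_contra hcon
  push Not at hcon
  exact h (eq_one_of_strictMono ((monotone_of_lo_le_hi hcon).strictMono_of_injective w.injective))

/-! ### The action of the generators -/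

section Hecke

variable {m N : ℕ} {q : ℂ}

theorem heckeGen_pureTensor (i : Fin (m - 1)) (a : Fin m → Fin (N + 1)) :
    heckeGen N q i (pureTensor a) =
      if a (lo i) = a (hi i) then q • pureTensor a
      else if a (lo i) < a (hi i) then
        pureTensor (a ∘ simpleRefl i) + (q - q⁻¹) • pureTensor a
      else pureTensor (a ∘ simpleRefl i) := by
  rw [← tensBasis_apply, heckeGen, Module.Basis.constr_basis, tensBasis_apply]

/-- Two endomorphisms agree if they agree on the tensors `I_{a 0} ⊗ ⋯ ⊗ I_{a (m-1)}`. -/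
theorem end_ext {A B : Module.End ℂ (Tens m N)}
    (h : ∀ a, A (pureTensor a) = B (pureTensor a)) : A = B :=
  (tensBasis m N).ext fun a => by rw [tensBasis_apply]; exact h a

theorem heckeGen_sq (hq0 : q ≠ 0) (i : Fin (m - 1)) :
    heckeGen N q i * heckeGen N q i = 1 + (q - q⁻¹) • heckeGen N q i := by
  refine end_ext fun a => ?_
  have hs : (a ∘ simpleRefl i) ∘ simpleRefl i = a := by
    funext k; simp [simpleRefl]
  simp only [Module.End.mul_apply, LinearMap.add_apply, LinearMap.smul_apply, Module.End.one_apply]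
  rcases lt_trichotomy (a (lo i)) (a (hi i)) with h | h | h
  · simp [heckeGen_pureTensor, h, h.ne, h.ne', h.not_gt, simpleRefl_lo, simpleRefl_hi, hs]
  · simp only [heckeGen_pureTensor, h, if_true, map_smul]
    match_scalars
    field_simp
    ring
  · simp [heckeGen_pureTensor, h, h.ne, h.ne', h.not_gt, simpleRefl_lo, simpleRefl_hi, hs]

/-- The operator of a generator on two neighbouring letters `x`, `y`, where `F x y` is a vector
depending on these letters. -/
noncomputable def localStep {α E : Type*} [LinearOrder α] [AddCommGroup E] [Module ℂ E]
    (q : ℂ) (F : α → α → E) (x y : α) : E :=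
  if x = y then q • F x y else if x < y then F y x + (q - q⁻¹) • F x y else F y x

/-- A generator acts only on the two letters at its positions, the rest of the word being
arbitrary. -/
theorem heckeGen_update (i : Fin (m - 1)) (a : Fin m → Fin (N + 1)) (x y : Fin (N + 1)) :
    heckeGen N q i (pureTensor (Function.update (Function.update a (lo i) x) (hi i) y)) =
      localStep q
        (fun x y => pureTensor (Function.update (Function.update a (lo i) x) (hi i) y)) x y := by
  have hne := (lo_lt_hi i).ne
  have hsw : Function.update (Function.update a (lo i) x) (hi i) y ∘ simpleRefl i =
      Function.update (Function.update a (lo i) y) (hi i) x := by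
    funext k
    by_cases h1 : k = lo i
    · subst h1; simp [simpleRefl_lo, hne]
    by_cases h2 : k = hi i
    · subst h2; simp [simpleRefl_hi, hne]
    simp [simpleRefl, Equiv.swap_apply_of_ne_of_ne h1 h2, h1, h2]
  rw [heckeGen_pureTensor, hsw, localStep]
  simp [hne]

/-- The braid relation, checked for each relative order of the three letters involved. -/
theorem braid_of_localStep (hq0 : q ≠ 0) {α E : Type*} [LinearOrder α] [AddCommGroup E]
    [Module ℂ E]
    {A B : Module.End ℂ E} {F : α → α → α → E}
    (hA : ∀ x y z, A (F x y z) = localStep q (fun x y => F x y z) x y)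
    (hB : ∀ x y z, B (F x y z) = localStep q (fun y z => F x y z) y z) (x y z : α) :
    A (B (A (F x y z))) = B (A (B (F x y z))) := by
  simp only [localStep] at hA hB
  rcases lt_trichotomy x y with h1 | h1 | h1 <;> rcases lt_trichotomy y z with h2 | h2 | h2 <;>
    rcases lt_trichotomy x z with h3 | h3 | h3 <;> try subst h1 <;> try subst h2 <;> try subst h3
  all_goals first
    | (exfalso; order)
    | (simp [*, ne_of_lt, ne_of_gt, not_lt_of_gt]; done)
    | (simp [*, ne_of_lt, ne_of_gt, not_lt_of_gt]; module)
    | (simp [*, ne_of_lt, ne_of_gt, not_lt_of_gt]; (match_scalars <;> field_simp); ring)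

theorem commute_of_localStep {α E : Type*} [LinearOrder α] [AddCommGroup E] [Module ℂ E]
    {A B : Module.End ℂ E} {F : α → α → α → α → E}
    (hA : ∀ x y z t, A (F x y z t) = localStep q (fun x y => F x y z t) x y)
    (hB : ∀ x y z t, B (F x y z t) = localStep q (fun z t => F x y z t) z t) (x y z t : α) :
    A (B (F x y z t)) = B (A (F x y z t)) := by
  simp only [localStep] at hA hB
  rcases lt_trichotomy x y with h1 | h1 | h1 <;> rcases lt_trichotomy z t with h2 | h2 | h2 <;>
    try subst h1 <;> try subst h2
  all_goals first
    | (simp [*, ne_of_lt, ne_of_gt, not_lt_of_gt]; done)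
    | (simp [*, ne_of_lt]; module)

theorem heckeGen_commute {i j : Fin (m - 1)} (h : (i : ℕ) + 1 < j) :
    heckeGen N q i * heckeGen N q j = heckeGen N q j * heckeGen N q i := by
  refine end_ext fun a => ?_
  have h1 : lo i ≠ lo j := by simp [lo]; omega
  have h2 : lo i ≠ hi j := by simp [lo, hi]; omega
  have h3 : hi i ≠ lo j := by simp [lo, hi]; omega
  have h4 : hi i ≠ hi j := by simp [hi]; omega
  let F : Fin (N + 1) → Fin (N + 1) → Fin (N + 1) → Fin (N + 1) → Tens m N := fun x y z t =>
    pureTensor (Function.update (Function.update (Function.update (Function.update a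
      (lo j) z) (hi j) t) (lo i) x) (hi i) y)
  have hF : F (a (lo i)) (a (hi i)) (a (lo j)) (a (hi j)) = pureTensor a := by
    simp [F]
  have hF' : ∀ x y z t, F x y z t =
      pureTensor (Function.update (Function.update (Function.update (Function.update a
        (lo i) x) (hi i) y) (lo j) z) (hi j) t) := by
    intro x y z t
    simp only [F]
    rw [Function.update_comm h2.symm, Function.update_comm h1.symm, Function.update_comm h4.symm,
      Function.update_comm h3.symm]
  have key := commute_of_localStep (q := q) (A := heckeGen N q i) (B := heckeGen N q j) (F := F)
    (fun x y z t => heckeGen_update i _ x y)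
    (fun x y z t => by simp only [hF']; exact heckeGen_update j _ z t)
    (a (lo i)) (a (hi i)) (a (lo j)) (a (hi j))
  rwa [hF] at key

theorem heckeGen_braid (hq0 : q ≠ 0) {i j : Fin (m - 1)} (h : hi i = lo j) :
    heckeGen N q i * (heckeGen N q j * heckeGen N q i) =
      heckeGen N q j * (heckeGen N q i * heckeGen N q j) := by
  refine end_ext fun a => ?_
  have h' : (i : ℕ) + 1 = j := congrArg Fin.val h
  have h2 : lo i ≠ hi j := by simp [lo, hi]; omega
  have h3 : lo i ≠ lo j := by simp [lo]; omega
  have h4 : hi i ≠ hi j := by simp [hi]; omega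
  let F : Fin (N + 1) → Fin (N + 1) → Fin (N + 1) → Tens m N := fun x y z =>
    pureTensor (Function.update (Function.update (Function.update a
      (hi j) z) (lo i) x) (hi i) y)
  have hF : F (a (lo i)) (a (hi i)) (a (hi j)) = pureTensor a := by
    simp [F]
  have hF' : ∀ x y z, F x y z =
      pureTensor (Function.update (Function.update (Function.update a
        (lo i) x) (lo j) y) (hi j) z) := by
    intro x y z
    simp only [F]
    rw [Function.update_comm h2.symm, Function.update_comm h4.symm, h]
  have key := braid_of_localStep (q := q) hq0 (A := heckeGen N q i) (B := heckeGen N q j) (F := F)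
    (fun x y z => heckeGen_update i _ x y)
    (fun x y z => by simp only [hF']; exact heckeGen_update j _ y z)
    (a (lo i)) (a (hi i)) (a (hi j))
  rwa [hF] at key

end Hecke

section Matsumoto
variable {m N : ℕ} {q : ℂ}

/-! ### Independence of the reduced word -/

theorem simpleRefl_apply_of_ne {m : ℕ} {i : Fin (m - 1)} {k : Fin m} (h1 : k ≠ lo i)
    (h2 : k ≠ hi i) : simpleRefl i k = k :=
  Equiv.swap_apply_of_ne_of_ne h1 h2

theorem IsReducedWord.append_singleton {l : List (Fin (m - 1))} {w : Equiv.Perm (Fin m)}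
    {i : Fin (m - 1)} (h : IsReducedWord l (w * simpleRefl i)) (hi' : w (hi i) < w (lo i)) :
    IsReducedWord (l ++ [i]) w := by
  refine ⟨?_, ?_⟩
  · rw [List.map_append, List.prod_append, h.1]
    simp [mul_assoc, simpleRefl_mul_self]
  · rw [List.length_append, h.2, List.length_singleton, inv_mul_simpleRefl w i hi']

theorem IsReducedWord.of_append_singleton {l : List (Fin (m - 1))} {w : Equiv.Perm (Fin m)}
    {i : Fin (m - 1)} (h : IsReducedWord (l ++ [i]) w) :
    w (hi i) < w (lo i) ∧ IsReducedWord l (w * simpleRefl i) := by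
  obtain ⟨h1, h2⟩ := h
  have h3 : (l.map simpleRefl).prod = w * simpleRefl i := by
    rw [← h1, List.map_append, List.prod_append]
    simp [mul_assoc, simpleRefl_mul_self]
  have h4 := inv_list_prod_le l
  rw [h3] at h4
  rw [List.length_append, List.length_singleton] at h2
  rcases lt_or_gt_lo_hi w i with h | h
  · have := inv_mul_simpleRefl_of_lt w i h
    omega
  · have := inv_mul_simpleRefl w i h
    exact ⟨h, h3, by omega⟩

/-- Matsumoto's theorem for the symmetric group: a map to a monoid that satisfies the braid
relations takes the same value on all reduced words of a permutation. -/
theorem IsReducedWord.prod_map_eq {G : Type*} [Monoid G] (T : Fin (m - 1) → G)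
    (hcomm : ∀ i j : Fin (m - 1), (i : ℕ) + 1 < j → T i * T j = T j * T i)
    (hbraid : ∀ i j : Fin (m - 1), hi i = lo j → T i * (T j * T i) = T j * (T i * T j))
    {l l' : List (Fin (m - 1))} {w : Equiv.Perm (Fin m)}
    (h : IsReducedWord l w) (h' : IsReducedWord l' w) : (l.map T).prod = (l'.map T).prod := by
  induction hn : inv w using Nat.strong_induction_on generalizing w l l' with
  | _ n ih =>
  have ih' : ∀ {u : Equiv.Perm (Fin m)} {k k' : List (Fin (m - 1))}, inv u < n →
      IsReducedWord k u → IsReducedWord k' u → (k.map T).prod = (k'.map T).prod :=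
    fun hu hk hk' => ih _ hu hk hk' rfl
  rcases List.eq_nil_or_concat l with rfl | ⟨l₁, i, rfl⟩
  · have : l' = [] := List.eq_nil_of_length_eq_zero (by rw [h'.2, ← h.2]; rfl)
    rw [this]
  rcases List.eq_nil_or_concat l' with rfl | ⟨l₂, j, rfl⟩
  · have := h.2.trans h'.2.symm
    simp at this
  rw [List.concat_eq_append] at *
  obtain ⟨hwi, hl₁⟩ := h.of_append_singleton
  obtain ⟨hwj, hl₂⟩ := h'.of_append_singleton
  have ei := inv_mul_simpleRefl w i hwi
  -- If `i ≠ j` are both descents of `w`, then `w` has reduced words ending in each of the two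
  -- reduced words of the longest element of `⟨s_i, s_j⟩`; these are `s_j s_i` and `s_i s_j` when
  -- `|i - j| > 1`, and the two sides of the braid relation when `|i - j| = 1`.
  have far : ∀ {i j : Fin (m - 1)} {l₁ l₂ : List (Fin (m - 1))}, (i : ℕ) + 1 < j →
      w (hi i) < w (lo i) → w (hi j) < w (lo j) → IsReducedWord l₁ (w * simpleRefl i) →
      IsReducedWord l₂ (w * simpleRefl j) →
      (l₁.map T).prod * T i = (l₂.map T).prod * T j := by
    intro i j l₁ l₂ hij hwi hwj hl₁ hl₂
    have ei := inv_mul_simpleRefl w i hwi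
    have ej := inv_mul_simpleRefl w j hwj
    have h1 : lo j ≠ lo i := by simp [lo]; omega
    have h2 : hi j ≠ lo i := by simp [lo, hi]; omega
    have h3 : lo j ≠ hi i := by simp [lo, hi]; omega
    have h4 : hi j ≠ hi i := by simp [hi]; omega
    have hd1 : (w * simpleRefl i) (hi j) < (w * simpleRefl i) (lo j) := by
      simpa [Equiv.Perm.mul_apply, simpleRefl_apply_of_ne, h1, h2, h3, h4] using hwj
    have hd2 : (w * simpleRefl j) (hi i) < (w * simpleRefl j) (lo i) := by
      simpa [Equiv.Perm.mul_apply, simpleRefl_apply_of_ne, h1.symm, h2.symm, h3.symm, h4.symm]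
        using hwi
    have hss : simpleRefl i * simpleRefl j = simpleRefl j * simpleRefl i := by
      apply Equiv.Perm.Disjoint.commute
      intro k
      by_cases hk : k = lo i ∨ k = hi i
      · right
        rcases hk with rfl | rfl
        · exact simpleRefl_apply_of_ne h1.symm h2.symm
        · exact simpleRefl_apply_of_ne h3.symm h4.symm
      · left
        push Not at hk
        exact simpleRefl_apply_of_ne hk.1 hk.2
    obtain ⟨l₃, hl₃⟩ := exists_isReducedWord (w * simpleRefl i * simpleRefl j)
    have r1 := hl₃.append_singleton hd1
    rw [mul_assoc, hss, ← mul_assoc] at hl₃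
    have r2 := hl₃.append_singleton hd2
    rw [ih' (by omega) hl₁ r1, ih' (by omega) hl₂ r2]
    simp [mul_assoc, hcomm i j hij]
  have near : ∀ {i j : Fin (m - 1)} {l₁ l₂ : List (Fin (m - 1))}, (i : ℕ) + 1 = j →
      w (hi i) < w (lo i) → w (hi j) < w (lo j) → IsReducedWord l₁ (w * simpleRefl i) →
      IsReducedWord l₂ (w * simpleRefl j) →
      (l₁.map T).prod * T i = (l₂.map T).prod * T j := by
    intro i j l₁ l₂ hij hwi hwj hl₁ hl₂
    have ei := inv_mul_simpleRefl w i hwi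
    have ej := inv_mul_simpleRefl w j hwj
    have h1 : hi i = lo j := Fin.ext hij
    have h2 : hi j ≠ lo i := by simp [lo, hi]; omega
    have h3 : hi j ≠ hi i := by simp [hi]; omega
    have h4 : lo i ≠ lo j := by simp [lo]; omega
    have t1 : simpleRefl i (hi j) = hi j := simpleRefl_apply_of_ne h2 h3
    have t2 : simpleRefl j (lo i) = lo i := simpleRefl_apply_of_ne h4 h2.symm
    have t3 : simpleRefl i (lo j) = lo i := by rw [← h1, simpleRefl_hi]
    have t4 : simpleRefl j (hi i) = hi j := by rw [h1, simpleRefl_lo]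
    rw [← h1] at hwj
    have hd1 : (w * simpleRefl i) (hi j) < (w * simpleRefl i) (lo j) := by
      simp only [Equiv.Perm.mul_apply, t1, t3]
      exact hwj.trans hwi
    have hd2 : (w * simpleRefl j) (hi i) < (w * simpleRefl j) (lo i) := by
      simp only [Equiv.Perm.mul_apply, t2, t4]
      exact hwj.trans hwi
    have hd3 : (w * simpleRefl i * simpleRefl j) (hi i) <
        (w * simpleRefl i * simpleRefl j) (lo i) := by
      simpa only [Equiv.Perm.mul_apply, t1, t2, t4, simpleRefl_lo] using hwj
    have hd4 : (w * simpleRefl j * simpleRefl i) (hi j) <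
        (w * simpleRefl j * simpleRefl i) (lo j) := by
      simpa only [Equiv.Perm.mul_apply, t1, t2, t3, simpleRefl_hi, ← h1] using hwi
    have hss : simpleRefl i * simpleRefl j * simpleRefl i =
        simpleRefl j * simpleRefl i * simpleRefl j := by
      have hb : simpleRefl j = Equiv.swap (hi i) (hi j) := by rw [simpleRefl, h1]
      have e1 := Equiv.swap_mul_swap_mul_swap (lo_lt_hi i).ne h2.symm
      have e2 := Equiv.swap_mul_swap_mul_swap h3 h2
      rw [Equiv.swap_comm _ (lo i), Equiv.swap_comm (hi j), Equiv.swap_comm (lo i) (hi j)] at e2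
      rw [hb, simpleRefl, e1, e2]
    have f1 := inv_mul_simpleRefl _ j hd1
    have f2 := inv_mul_simpleRefl _ i hd2
    obtain ⟨l₃, hl₃⟩ := exists_isReducedWord (w * simpleRefl i * simpleRefl j * simpleRefl i)
    have r1 := (hl₃.append_singleton hd3).append_singleton hd1
    rw [mul_assoc, mul_assoc, ← mul_assoc (simpleRefl i), hss, ← mul_assoc, ← mul_assoc] at hl₃
    have r2 := (hl₃.append_singleton hd4).append_singleton hd2
    rw [ih' (by omega) hl₁ r1, ih' (by omega) hl₂ r2]
    simp [mul_assoc, hbraid i j h1]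
  simp only [List.concat_eq_append, List.map_append, List.prod_append, List.map_singleton,
    List.prod_singleton]
  rcases lt_trichotomy (i : ℕ) j with hij | hij | hij
  · rcases (Nat.succ_le_of_lt hij).lt_or_eq with hij | hij
    · exact far hij hwi hwj hl₁ hl₂
    · exact near hij hwi hwj hl₁ hl₂
  · obtain rfl := Fin.ext hij
    rw [ih' (by omega) hl₁ hl₂]
  · rcases (Nat.succ_le_of_lt hij).lt_or_eq with hij | hij
    · exact (far hij hwj hwi hl₂ hl₁).symm
    · exact (near hij hwj hwi hl₂ hl₁).symm

theorem heckeT_eq_of_isReducedWord (hq0 : q ≠ 0) {l : List (Fin (m - 1))}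
    {w : Equiv.Perm (Fin m)} (h : IsReducedWord l w) :
    heckeT N q w = (l.map (heckeGen N q)).prod :=
  (exists_isReducedWord w).choose_spec.prod_map_eq (heckeGen N q)
    (fun _ _ => heckeGen_commute) (fun _ _ => heckeGen_braid hq0) h

/-! ### The image of the symmetrizer -/

theorem heckeGen_mul_heckeT_of_lt (hq0 : q ≠ 0) {i : Fin (m - 1)} {w : Equiv.Perm (Fin m)}
    (h : w⁻¹ (lo i) < w⁻¹ (hi i)) :
    heckeGen N q i * heckeT N q w = heckeT N q (simpleRefl i * w) := by
  obtain ⟨l, hl⟩ := exists_isReducedWord w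
  have hl' : IsReducedWord (i :: l) (simpleRefl i * w) :=
    ⟨by rw [List.map_cons, List.prod_cons, hl.1],
      by rw [List.length_cons, hl.2, inv_simpleRefl_mul_of_lt w i h]⟩
  rw [heckeT_eq_of_isReducedWord hq0 hl, heckeT_eq_of_isReducedWord hq0 hl', List.map_cons,
    List.prod_cons]

theorem heckeGen_mul_heckeT_of_gt (hq0 : q ≠ 0) {i : Fin (m - 1)} {w : Equiv.Perm (Fin m)}
    (h : w⁻¹ (hi i) < w⁻¹ (lo i)) :
    heckeGen N q i * heckeT N q w =
      heckeT N q (simpleRefl i * w) + (q - q⁻¹) • heckeT N q w := by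
  have h' : (simpleRefl i * w)⁻¹ (lo i) < (simpleRefl i * w)⁻¹ (hi i) := by
    simpa [mul_inv_rev, simpleRefl_inv, Equiv.Perm.mul_apply, simpleRefl_lo, simpleRefl_hi] using h
  have key := heckeGen_mul_heckeT_of_lt (N := N) hq0 h'
  rw [← mul_assoc, simpleRefl_mul_self, one_mul] at key
  rw [← key, ← mul_assoc, heckeGen_sq hq0, add_mul, one_mul, smul_mul_assoc]

theorem heckeGen_mul_sum (hq0 : q ≠ 0) (i : Fin (m - 1)) :
    heckeGen N q i * ∑ w : Equiv.Perm (Fin m), q ^ inv w • heckeT N q w =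
      q • ∑ w : Equiv.Perm (Fin m), q ^ inv w • heckeT N q w := by
  classical
  -- The image of the term of `w` is `f (s_i w) + g w`, and `f + g` is `q` times the term.
  let f : Equiv.Perm (Fin m) → Module.End ℂ (Tens m N) := fun w =>
    q ^ inv (simpleRefl i * w) • heckeT N q w
  let g : Equiv.Perm (Fin m) → Module.End ℂ (Tens m N) := fun w =>
    if w⁻¹ (hi i) < w⁻¹ (lo i) then (q ^ inv w * (q - q⁻¹)) • heckeT N q w else 0
  have h1 : ∀ w, heckeGen N q i * (q ^ inv w • heckeT N q w) = f (simpleRefl i * w) + g w := by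
    intro w
    simp only [f, g]
    rw [← mul_assoc, simpleRefl_mul_self, one_mul, mul_smul_comm]
    rcases lt_or_gt_lo_hi w⁻¹ i with h | h
    · rw [heckeGen_mul_heckeT_of_lt hq0 h, if_neg h.not_gt, add_zero]
    · rw [heckeGen_mul_heckeT_of_gt hq0 h, if_pos h, smul_add, smul_smul]
  have h2 : ∀ w, f w + g w = q • (q ^ inv w • heckeT N q w) := by
    intro w
    simp only [f, g]
    rcases lt_or_gt_lo_hi w⁻¹ i with h | h
    · rw [inv_simpleRefl_mul_of_lt w i h, if_neg h.not_gt, add_zero, smul_smul, pow_succ']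
    · rw [← inv_simpleRefl_mul w i h, if_pos h, smul_smul, ← add_smul]
      congr 1
      field_simp
      ring
  rw [Finset.mul_sum, Finset.smul_sum]
  simp_rw [h1, ← h2, Finset.sum_add_distrib]
  congr 1
  exact Equiv.sum_comp (Equiv.mulLeft (simpleRefl i)) f

/-- The `q`-symmetric tensors: the common eigenvectors of the generators with eigenvalue `q`. -/
noncomputable def symTensors (m N : ℕ) (q : ℂ) : Submodule ℂ (Tens m N) :=
  ⨅ i : Fin (m - 1), LinearMap.ker (heckeGen N q i - q • 1)

theorem mem_symTensors {x : Tens m N} :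
    x ∈ symTensors m N q ↔ ∀ i, heckeGen N q i x = q • x := by
  simp [symTensors, sub_eq_zero]

theorem symProj_mem_symTensors (hq0 : q ≠ 0) (x : Tens m N) :
    symProj m N q x ∈ symTensors m N q := by
  rw [mem_symTensors]
  intro i
  have := congrArg (fun A : Module.End ℂ (Tens m N) => A x) (heckeGen_mul_sum (N := N) hq0 i)
  simp only [Module.End.mul_apply, LinearMap.smul_apply] at this
  rw [symProj, LinearMap.smul_apply, map_smul, this, smul_comm]

theorem heckeT_apply_of_mem {x : Tens m N} (hx : x ∈ symTensors m N q)
    (w : Equiv.Perm (Fin m)) : heckeT N q w x = q ^ inv w • x := by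
  rw [← (exists_isReducedWord w).choose_spec.2, heckeT]
  generalize (exists_isReducedWord w).choose = l
  induction l with
  | nil => simp
  | cons i l ih =>
    rw [List.map_cons, List.prod_cons, Module.End.mul_apply, ih, map_smul,
      mem_symTensors.1 hx i, smul_smul, List.length_cons, pow_succ]

/-! ### The Poincaré polynomial of the symmetric group -/

/-- The permutation that sends `0` to `p` and maps the other positions to the values different
from `p` in the relative order prescribed by `e`. The inverse of the cycle `(0 1 ⋯ p)`, rather than
a transposition, makes its number of inversions `p + inv e`. -/
noncomputable def insertZero {n : ℕ} (p : Fin (n + 1) × Equiv.Perm (Fin n)) :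
    Equiv.Perm (Fin (n + 1)) :=
  p.1.cycleRange⁻¹ * Equiv.Perm.decomposeFin.symm (0, p.2)

theorem insertZero_zero {n : ℕ} (p : Fin (n + 1) × Equiv.Perm (Fin n)) :
    insertZero p 0 = p.1 := by
  simp [insertZero, Equiv.Perm.inv_def]

theorem insertZero_succ {n : ℕ} (p : Fin (n + 1) × Equiv.Perm (Fin n)) (k : Fin n) :
    insertZero p k.succ = p.1.succAbove (p.2 k) := by
  simp [insertZero, Equiv.Perm.inv_def]

theorem insertZero_bijective {n : ℕ} : Function.Bijective (insertZero (n := n)) := by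
  rw [Fintype.bijective_iff_injective_and_card]
  refine ⟨?_, by simp [Fintype.card_perm, Nat.factorial_succ]⟩
  rintro ⟨p, e⟩ ⟨p', e'⟩ h
  have h0 : p = p' := by
    have := DFunLike.congr_fun h 0
    rwa [insertZero_zero, insertZero_zero] at this
  subst h0
  refine Prod.ext rfl (Equiv.ext fun k => ?_)
  have := DFunLike.congr_fun h k.succ
  rw [insertZero_succ, insertZero_succ] at this
  exact Fin.succAbove_right_injective this

theorem inv_insertZero {n : ℕ} (p : Fin (n + 1) × Equiv.Perm (Fin n)) :
    inv (insertZero p) = p.1 + inv p.2 := by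
  obtain ⟨p, e⟩ := p
  have h1 : ∀ (n : ℕ) (w : Equiv.Perm (Fin n)),
      inv w = ∑ a, ∑ b, if a < b ∧ w b < w a then 1 else 0 := by
    intro n w
    rw [inv, Finset.card_filter, Fintype.sum_prod_type]
  rw [h1, h1, Fin.sum_univ_succ, Fin.sum_univ_succ]
  simp only [Fin.sum_univ_succ (n := n), insertZero_zero, insertZero_succ, Fin.succ_lt_succ_iff,
    Fin.succ_pos, Fin.not_lt_zero, lt_self_iff_false, false_and, true_and, if_false, zero_add,
    Fin.succAbove_lt_succAbove_iff]
  congr 1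
  have h2 := Equiv.sum_comp e fun b => if p.succAbove b < p then 1 else 0
  rw [h2]
  simp only [Fin.succAbove_lt_iff_castSucc_lt]
  -- The inversions of the form `(0, k + 1)` correspond to the values below `p`.
  rw [← Finset.card_filter]
  simp only [Fin.lt_def, Fin.val_castSucc, Fin.card_filter_val_lt]
  omega

theorem sum_pow_inv (m : ℕ) (q : ℂ) :
    ∑ w : Equiv.Perm (Fin m), q ^ (2 * inv w) = ∏ k ∈ Finset.range m, qInt q (k + 1) := by
  induction m with
  | zero => simp [inv]
  | succ n ih =>
    rw [← (Equiv.ofBijective _ insertZero_bijective).sum_comp, Fintype.sum_prod_type,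
      Finset.prod_range_succ, ← ih, mul_comm, qInt, Finset.sum_range, Finset.sum_mul_sum]
    simp [inv_insertZero, mul_add, pow_add]

/-! ### The symmetrizer is a projection -/

theorem symProj_apply_of_mem (hq : ∀ k : ℕ, 1 ≤ k → k ≤ m → qInt q k ≠ 0) {x : Tens m N}
    (hx : x ∈ symTensors m N q) : symProj m N q x = x := by
  have h : ∏ k ∈ Finset.range m, qInt q (k + 1) ≠ 0 :=
    Finset.prod_ne_zero_iff.2 fun k hk => hq _ (by omega) (Finset.mem_range.1 hk)
  simp only [symProj, LinearMap.smul_apply, LinearMap.sum_apply, heckeT_apply_of_mem hx, smul_smul]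
  rw [← Finset.sum_smul, smul_smul]
  simp only [← pow_add, ← two_mul, sum_pow_inv]
  rw [inv_mul_cancel₀ h, one_smul]

theorem range_symProj (hq0 : q ≠ 0) (hq : ∀ k : ℕ, 1 ≤ k → k ≤ m → qInt q k ≠ 0) :
    LinearMap.range (symProj m N q) = symTensors m N q := by
  refine le_antisymm ?_ fun x hx => ⟨x, symProj_apply_of_mem hq hx⟩
  rintro _ ⟨x, rfl⟩
  exact symProj_mem_symTensors hq0 x

end Matsumoto

section Words
variable {m N : ℕ} {q : ℂ}

/-! ### Minimal coset representatives -/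

theorem letter_monotone (μ : Comp m N) : Monotone (letter μ) := by
  have key : ∀ x y : (i : Fin (N + 1)) × Fin (μ.1 i), x.1 < y.1 →
      finSigmaFinEquiv x < finSigmaFinEquiv y := by
    intro x y hxy
    rw [Fin.lt_def, finSigmaFinEquiv_apply, finSigmaFinEquiv_apply]
    have h1 : ∀ j : Fin (N + 1), ∑ i : Fin j, μ.1 (Fin.castLE j.2.le i) =
        ∑ i ∈ Finset.univ.filter (· < j), μ.1 i := by
      intro j
      refine Finset.sum_bij' (fun i _ => Fin.castLE j.2.le i)
        (fun i hi => ⟨i, (Finset.mem_filter.1 hi).2⟩) ?_ ?_ ?_ ?_ ?_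
      · exact fun i _ => Finset.mem_filter.2 ⟨Finset.mem_univ _, i.2⟩
      all_goals simp
    rw [h1, h1]
    have h2 : ∑ i ∈ insert x.1 (Finset.univ.filter (· < x.1)), μ.1 i ≤
        ∑ i ∈ Finset.univ.filter (· < y.1), μ.1 i := by
      refine Finset.sum_le_sum_of_subset fun i hi => ?_
      simp only [Finset.mem_insert, Finset.mem_filter, Finset.mem_univ, true_and] at hi ⊢
      rcases hi with rfl | hi
      · exact hxy
      · exact hi.trans hxy
    rw [Finset.sum_insert (by simp)] at h2
    have := x.2.2
    omega
  intro a b hab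
  by_contra hcon
  push Not at hcon
  have := key _ _ hcon
  simp only [Equiv.apply_symm_apply, Fin.lt_def, Fin.val_cast] at this
  rw [Fin.le_def] at hab
  omega

theorem card_letter_eq (μ : Comp m N) (j : Fin (N + 1)) :
    Fintype.card {k // letter μ k = j} = μ.1 j := by
  rw [← Fintype.card_fin (μ.1 j)]
  refine Fintype.card_congr ?_
  refine (Equiv.subtypeEquiv ((finCongr μ.2.symm).trans finSigmaFinEquiv.symm)
    (q := fun x => x.1 = j) fun k => Iff.rfl).trans ?_
  exact Equiv.sigmaSubtype j

/-- Minimal coset representatives are increasing on each block. -/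
theorem lt_of_mem_minReps {μ : Comp m N} {σ : Equiv.Perm (Fin m)} (hσ : σ ∈ minReps μ)
    {k l : Fin m} (hkl : k < l) (h : letter μ k = letter μ l) : σ k < σ l := by
  have hmin : ∀ h ∈ young μ, inv σ ≤ inv (σ * h) := by simpa [minReps] using hσ
  have step : ∀ i : Fin (m - 1), letter μ (lo i) = letter μ (hi i) → σ (lo i) < σ (hi i) := by
    intro i hi'
    refine (lt_or_gt_lo_hi σ i).resolve_right fun hlt => ?_
    have h1 := inv_mul_simpleRefl σ i hlt
    have h2 := hmin (simpleRefl i) (fun k => by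
      by_cases hk : k = lo i
      · rw [hk, simpleRefl_lo, hi']
      by_cases hk' : k = hi i
      · rw [hk', simpleRefl_hi, hi']
      rw [simpleRefl_apply_of_ne hk hk'])
    omega
  -- Blocks are intervals, so the lexicographic order on (block, value) passes from neighbouring
  -- positions to all positions.
  have hmono : Monotone fun k => toLex (letter μ k, σ k) := by
    refine monotone_of_lo_le_hi fun i => ?_
    rcases (letter_monotone μ (lo_lt_hi i).le).lt_or_eq with h | h
    · exact (Prod.Lex.lt_iff.2 (Or.inl h)).le
    · exact (Prod.Lex.lt_iff.2 (Or.inr ⟨by simpa using h, step i h⟩)).le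
  rcases Prod.Lex.le_iff.1 (hmono hkl.le) with h' | h'
  · exact absurd h h'.ne
  · exact lt_of_le_of_ne h'.2 fun h'' => hkl.ne (σ.injective h'')

/-- A coset contains at most one permutation that is increasing on each block. -/
theorem eq_one_of_increasing {μ : Comp m N} {σ h : Equiv.Perm (Fin m)} (hh : h ∈ young μ)
    (h1 : ∀ k l, k < l → letter μ k = letter μ l → σ k < σ l)
    (h2 : ∀ k l, k < l → letter μ k = letter μ l → (σ * h) k < (σ * h) l) : h = 1 := by
  refine eq_one_of_strictMono fun k l hkl => ?_
  rcases (letter_monotone μ hkl.le).lt_or_eq with hlt | heq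
  · rw [← hh k, ← hh l] at hlt
    exact (letter_monotone μ).reflect_lt hlt
  · refine lt_of_not_ge fun hge => ?_
    rcases hge.lt_or_eq with hlt | heq'
    · exact lt_asymm (h2 k l hkl heq) (h1 _ _ hlt (by rw [hh, hh, heq]))
    · exact hkl.ne' (h.injective heq')

theorem exists_mem_minReps (μ : Comp m N) (σ : Equiv.Perm (Fin m)) :
    ∃ h ∈ young μ, σ * h ∈ minReps μ := by
  classical
  obtain ⟨h, hh, hmin⟩ := Finset.exists_min_image
    (Finset.univ.filter fun h => h ∈ young μ) (fun h => inv (σ * h)) ⟨1, by simp [one_mem]⟩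
  simp only [Finset.mem_filter, Finset.mem_univ, true_and] at hh hmin
  refine ⟨h, hh, ?_⟩
  simp only [minReps, Finset.mem_filter, Finset.mem_univ, true_and]
  intro h' hh'
  rw [mul_assoc]
  exact hmin _ (mul_mem hh hh')

theorem mem_minReps_iff {μ : Comp m N} {σ : Equiv.Perm (Fin m)} :
    σ ∈ minReps μ ↔ ∀ k l, k < l → letter μ k = letter μ l → σ k < σ l := by
  refine ⟨fun h k l => lt_of_mem_minReps h, fun h1 => ?_⟩
  obtain ⟨h, hh, hmem⟩ := exists_mem_minReps μ σ
  have := eq_one_of_increasing hh h1 fun k l => lt_of_mem_minReps hmem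
  rwa [this, mul_one] at hmem

theorem one_mem_minReps (μ : Comp m N) : 1 ∈ minReps μ :=
  mem_minReps_iff.2 fun _ _ h _ => h

theorem eq_one_of_mem_minReps {μ : Comp m N} {σ : Equiv.Perm (Fin m)} (hσ : σ ∈ minReps μ)
    (h : σ ∈ young μ) : σ = 1 :=
  eq_one_of_increasing h (mem_minReps_iff.1 (one_mem_minReps μ))
    (by simpa using mem_minReps_iff.1 hσ)

/-- Exchanging two neighbouring distinct letters of a word replaces the minimal coset
representative `σ` by `s_i σ`. -/
theorem simpleRefl_mul_mem_minReps {μ : Comp m N} {σ : Equiv.Perm (Fin m)} {i : Fin (m - 1)}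
    (hσ : σ ∈ minReps μ) (h : letter μ (σ⁻¹ (lo i)) ≠ letter μ (σ⁻¹ (hi i))) :
    simpleRefl i * σ ∈ minReps μ := by
  rw [mem_minReps_iff] at hσ ⊢
  intro k l hkl hl
  refine simpleRefl_lt i (hσ k l hkl hl) ?_
  rintro ⟨h1, h2⟩
  rw [← h1, ← h2] at h
  exact h (by simpa using hl)

theorem letter_lt_of_mem_minReps {μ : Comp m N} {σ : Equiv.Perm (Fin m)} {i : Fin (m - 1)}
    (hσ : σ ∈ minReps μ) (h : σ⁻¹ (hi i) < σ⁻¹ (lo i)) :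
    letter μ (σ⁻¹ (hi i)) < letter μ (σ⁻¹ (lo i)) := by
  refine lt_of_le_of_ne (letter_monotone μ h.le) fun heq => ?_
  have := mem_minReps_iff.1 hσ _ _ h heq
  exact lt_asymm (lo_lt_hi i) (by simpa using this)

/-- Every word arises from a minimal coset representative. -/
theorem exists_letter_comp_eq (a : Fin m → Fin (N + 1)) :
    ∃ μ : Comp m N, ∃ σ ∈ minReps μ, letter μ ∘ ⇑σ⁻¹ = a := by
  classical
  let μ : Comp m N := ⟨fun j => Fintype.card {k // a k = j}, by
    rw [← Fintype.card_sigma, Fintype.card_congr (Equiv.sigmaFiberEquiv a), Fintype.card_fin]⟩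
  have e : ∀ j, {k // letter μ k = j} ≃ {k // a k = j} := fun j =>
    Fintype.equivOfCardEq (card_letter_eq μ j)
  let σ : Equiv.Perm (Fin m) := Equiv.ofFiberEquiv e
  have hσ : ∀ k, a (σ k) = letter μ k := fun k => Equiv.ofFiberEquiv_map e k
  obtain ⟨h, hh, hmem⟩ := exists_mem_minReps μ σ
  refine ⟨μ, σ * h, hmem, funext fun k => ?_⟩
  obtain ⟨l, rfl⟩ := (σ * h).surjective k
  rw [Function.comp_apply, ← Equiv.Perm.mul_apply (σ * h)⁻¹, inv_mul_cancel,
    Equiv.Perm.one_apply, Equiv.Perm.mul_apply, hσ, hh]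

theorem eq_of_letter_comp_eq {μ ν : Comp m N} {σ : Equiv.Perm (Fin m)}
    (h : letter μ ∘ ⇑σ = letter ν) : μ = ν := by
  refine Subtype.ext (funext fun j => ?_)
  rw [← card_letter_eq, ← card_letter_eq]
  exact (Fintype.card_congr (Equiv.subtypeEquiv σ fun k => by rw [← h]; rfl)).symm

/-! ### The vectors `M μ` -/

theorem place_pureTensor (σ : Equiv.Perm (Fin m)) (a : Fin m → Fin (N + 1)) :
    place σ (pureTensor a) = pureTensor (a ∘ ⇑σ⁻¹) := by
  simp only [place, pureTensor]
  erw [PiTensorProduct.reindex_tprod]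
  rfl

theorem M_eq (q : ℂ) (μ : Comp m N) :
    M q μ = ∑ σ ∈ minReps μ, (q ^ inv σ)⁻¹ • pureTensor (letter μ ∘ ⇑σ⁻¹) := by
  simp only [M, vec, place_pureTensor]

theorem M_mem_symTensors (hq0 : q ≠ 0) (μ : Comp m N) : M q μ ∈ symTensors m N q := by
  classical
  rw [mem_symTensors]
  intro i
  let E : Equiv.Perm (Fin m) → Tens m N := fun σ => pureTensor (letter μ ∘ ⇑σ⁻¹)
  let P : Equiv.Perm (Fin m) → Prop := fun σ =>
    letter μ (σ⁻¹ (lo i)) = letter μ (σ⁻¹ (hi i))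
  -- The involution of the words that exchanges the letters at positions `i` and `i + 1`.
  let r : Equiv.Perm (Fin m) → Equiv.Perm (Fin m) := fun σ =>
    if P σ then σ else simpleRefl i * σ
  have hP : ∀ σ, P (simpleRefl i * σ) ↔ P σ := fun σ => by
    simp only [P, mul_inv_rev, simpleRefl_inv, Equiv.Perm.mul_apply, simpleRefl_lo, simpleRefl_hi]
    exact eq_comm
  have hr : ∀ σ, r (r σ) = σ := fun σ => by
    by_cases h : P σ
    · simp [r, h]
    · simp [r, h, hP, ← mul_assoc, simpleRefl_mul_self]
  have hrmem : ∀ σ ∈ minReps μ, r σ ∈ minReps μ := fun σ hσ => by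
    by_cases h : P σ
    · simpa [r, h] using hσ
    · simpa [r, h] using simpleRefl_mul_mem_minReps hσ h
  -- The image of the term of `σ` is `f (r σ) + g σ`, and `f + g` is `q` times the term.
  let f : Equiv.Perm (Fin m) → Tens m N := fun σ => (q ^ inv (r σ))⁻¹ • E σ
  let g : Equiv.Perm (Fin m) → Tens m N := fun σ => q • (q ^ inv σ)⁻¹ • E σ - f σ
  have key : ∀ σ ∈ minReps μ, heckeGen N q i ((q ^ inv σ)⁻¹ • E σ) = f (r σ) + g σ := by
    intro σ hσ
    have hE : (letter μ ∘ ⇑σ⁻¹) ∘ simpleRefl i = letter μ ∘ ⇑(simpleRefl i * σ)⁻¹ := by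
      rw [mul_inv_rev, simpleRefl_inv]; rfl
    simp only [f, g, hr]
    by_cases h : P σ
    · have h' : letter μ (σ⁻¹ (lo i)) = letter μ (σ⁻¹ (hi i)) := h
      simp only [r, if_pos h, E, map_smul, heckeGen_pureTensor, Function.comp_apply, if_pos h']
      module
    · have h' : letter μ (σ⁻¹ (lo i)) ≠ letter μ (σ⁻¹ (hi i)) := h
      simp only [r, if_neg h, E, map_smul, heckeGen_pureTensor, Function.comp_apply, if_neg h', hE]
      rcases lt_or_gt_lo_hi σ⁻¹ i with hlt | hgt
      · rw [if_pos ((letter_monotone μ hlt.le).lt_of_ne h'), inv_simpleRefl_mul_of_lt σ i hlt]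
        match_scalars <;> field_simp
        ring
      · rw [if_neg (letter_monotone μ hgt.le).not_gt, ← inv_simpleRefl_mul σ i hgt]
        match_scalars <;> field_simp
        ring
  have hfr : ∑ σ ∈ minReps μ, f (r σ) = ∑ σ ∈ minReps μ, f σ :=
    Finset.sum_nbij' r r hrmem hrmem (fun σ _ => hr σ) (fun σ _ => hr σ) fun _ _ => rfl
  rw [M_eq, map_sum, Finset.sum_congr rfl key, Finset.sum_add_distrib, hfr,
    ← Finset.sum_add_distrib, Finset.smul_sum]
  exact Finset.sum_congr rfl fun σ _ => by simp only [g]; abel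

/-- The coefficient of a vector at the basis vector `I_{a 0} ⊗ ⋯ ⊗ I_{a (m-1)}`. -/
noncomputable def coeff (a : Fin m → Fin (N + 1)) : Tens m N →ₗ[ℂ] ℂ := (tensBasis m N).coord a

theorem coeff_pureTensor (a b : Fin m → Fin (N + 1)) :
    coeff a (pureTensor b) = if b = a then 1 else 0 := by
  rw [coeff, ← tensBasis_apply, Module.Basis.coord_apply, Module.Basis.repr_self,
    Finsupp.single_apply]

theorem eq_zero_of_coeff {x : Tens m N} (h : ∀ a, coeff a x = 0) : x = 0 :=
  (tensBasis m N).ext_elem fun a => by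
    rw [map_zero, Finsupp.zero_apply]; exact h a

theorem coeff_heckeGen {i : Fin (m - 1)} {b : Fin m → Fin (N + 1)} (h : b (hi i) < b (lo i))
    (x : Tens m N) : coeff b (heckeGen N q i x) = coeff (b ∘ simpleRefl i) x := by
  suffices coeff b ∘ₗ heckeGen N q i = coeff (b ∘ simpleRefl i) from LinearMap.congr_fun this x
  refine (tensBasis m N).ext fun a => ?_
  have hs : ∀ c : Fin m → Fin (N + 1), (c ∘ simpleRefl i) ∘ simpleRefl i = c := fun c => by
    funext k; simp [simpleRefl]
  have hiff : a ∘ simpleRefl i = b ↔ a = b ∘ simpleRefl i :=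
    ⟨fun h => by rw [← h, hs], fun h => by rw [h, hs]⟩
  rw [LinearMap.comp_apply, tensBasis_apply, heckeGen_pureTensor, coeff_pureTensor]
  by_cases hab : a = b
  · subst hab
    rw [if_neg h.ne', if_neg h.not_gt, coeff_pureTensor]
    simp only [hiff]
  split_ifs with h1 h2 h3 h4 h5
  · subst h2
    simp [simpleRefl_lo, simpleRefl_hi, h.ne] at h1
  all_goals simp_all [coeff_pureTensor]

/-- In a `q`-symmetric tensor, exchanging two neighbouring letters that are in decreasing order
multiplies the coefficient by `q`; hence all coefficients are determined by those at the sorted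
words. -/
theorem coeff_of_mem_symTensors {x : Tens m N} (hx : x ∈ symTensors m N q)
    (μ : Comp m N) {σ : Equiv.Perm (Fin m)} (hσ : σ ∈ minReps μ) :
    q ^ inv σ * coeff (letter μ ∘ ⇑σ⁻¹) x = coeff (letter μ) x := by
  induction hn : inv σ generalizing σ with
  | zero =>
    have : σ = 1 := by
      by_contra hne
      obtain ⟨i, hi'⟩ := exists_descent hne
      have := inv_mul_simpleRefl σ i hi'
      omega
    subst this
    simp
  | succ n ih =>
    have hne : σ⁻¹ ≠ 1 := fun h => by
      rw [← inv_inv_eq, h, inv_one] at hn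
      omega
    obtain ⟨i, hi'⟩ := exists_descent hne
    have hlt := letter_lt_of_mem_minReps hσ hi'
    have h1 := ih (simpleRefl_mul_mem_minReps hσ hlt.ne') (by
      have := inv_simpleRefl_mul σ i hi'
      omega)
    have h2 := coeff_heckeGen (q := q) (b := letter μ ∘ ⇑σ⁻¹) hlt x
    rw [mem_symTensors.1 hx i, map_smul, smul_eq_mul] at h2
    rw [← h1, mul_inv_rev, simpleRefl_inv, Equiv.Perm.coe_mul, ← Function.comp_assoc, ← h2,
      pow_succ, mul_assoc]

theorem coeff_letter_M (μ ν : Comp m N) :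
    coeff (letter ν) (M q μ) = if μ = ν then 1 else 0 := by
  rw [M_eq, map_sum, Finset.sum_eq_single 1]
  · simp only [inv_one, pow_zero, _root_.inv_one, one_smul, Equiv.Perm.coe_one,
      Function.comp_id, coeff_pureTensor]
    congr 1
    exact propext ⟨fun h => eq_of_letter_comp_eq (σ := 1) (by simpa using h), fun h => by rw [h]⟩
  · intro σ hσ hne
    rw [map_smul, coeff_pureTensor, if_neg, smul_zero]
    intro h
    obtain rfl := eq_of_letter_comp_eq h
    refine hne (eq_one_of_mem_minReps hσ fun k => ?_)
    have := congrFun h (σ k)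
    simpa using this.symm
  · exact fun h => absurd (one_mem_minReps μ) h

theorem linearIndependent_M (m N : ℕ) (q : ℂ) :
    LinearIndependent ℂ (M q : Comp m N → Tens m N) := by
  rw [linearIndependent_iff']
  intro s c hc ν hν
  have := congrArg (coeff (letter ν)) hc
  simpa [map_sum, coeff_letter_M, hν] using this

instance (m N : ℕ) : Finite (Comp m N) :=
  Finite.of_injective (fun μ i => (⟨μ.1 i, Nat.lt_succ_of_le
    ((Finset.single_le_sum (fun _ _ => Nat.zero_le _) (Finset.mem_univ i)).trans μ.2.le)⟩ :
      Fin (m + 1))) fun _ _ h => Subtype.ext (funext fun i => congrArg Fin.val (congrFun h i))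

theorem span_M (hq0 : q ≠ 0) :
    Submodule.span ℂ (Set.range (M q : Comp m N → Tens m N)) = symTensors m N q := by
  classical
  have := Fintype.ofFinite (Comp m N)
  refine le_antisymm (Submodule.span_le.2 ?_) fun x hx => ?_
  · rintro _ ⟨μ, rfl⟩
    exact M_mem_symTensors hq0 μ
  have hsum : ∑ μ : Comp m N, coeff (letter μ) x • M q μ ∈ symTensors m N q :=
    Submodule.sum_mem _ fun μ _ => Submodule.smul_mem _ _ (M_mem_symTensors hq0 μ)
  have h0 : x - ∑ μ : Comp m N, coeff (letter μ) x • M q μ = 0 := by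
    refine eq_zero_of_coeff fun a => ?_
    obtain ⟨ν, σ, hσ, rfl⟩ := exists_letter_comp_eq a
    refine (mul_eq_zero.1 (?_ : q ^ inv σ * _ = 0)).resolve_left (pow_ne_zero _ hq0)
    rw [coeff_of_mem_symTensors (Submodule.sub_mem _ hx hsum) ν hσ]
    simp [map_sum, coeff_letter_M]
  rw [sub_eq_zero.1 h0]
  exact Submodule.sum_mem _ fun μ _ =>
    Submodule.smul_mem _ _ (Submodule.subset_span (Set.mem_range_self μ))

end Words
end QSym

theorem mainTheorem2 (m N : ℕ) (q : ℂ) (hq0 : q ≠ 0)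
    (hq : ∀ k : ℕ, 1 ≤ k → k ≤ m → QSym.qInt q k ≠ 0) :
    ∃ b : Module.Basis (QSym.Comp m N) ℂ (LinearMap.range (QSym.symProj m N q)),
      ∀ μ : QSym.Comp m N, (b μ : QSym.Tens m N) = QSym.M q μ := by
  have h : Submodule.span ℂ (Set.range (QSym.M q : QSym.Comp m N → QSym.Tens m N)) =
      LinearMap.range (QSym.symProj m N q) := by
    rw [QSym.span_M hq0, QSym.range_symProj hq0 hq]
  refine ⟨(Module.Basis.span (QSym.linearIndependent_M m N q)).map (LinearEquiv.ofEq _ _ h),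
    fun μ => ?_⟩
  rw [Module.Basis.map_apply, LinearEquiv.coe_ofEq_apply, Module.Basis.span_apply]
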